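/- Theorem 5.8. Let $\mathbf F_r$ be a finite field with $r$ elements, let $\pi\in\mathbf F_r[T]$ be irreducible of degree $d$, let $\mathcal O=\widehat{\mathbf F_r[T]}_\pi=\mathbf F_\pi[[\pi]]$ be the $\pi$-adic completion of $\mathbf F_r[T]$ and $K$ its fraction field, with its $\pi$-adic absolute value $|\cdot|$ normalised by $|\pi|=r^{-d}$. Here $\mathbf F_\pi=\{a\in\mathcal O: a^{r^d}=a\}$ is the canonical copy of the residue field in $\mathcal O$. Let $C(\mathcal O,K)$ be the $K$-Banach space of continuous functions $\mathcal O\to K$ with the sup-norm, and $\operatorname{Hom}_{\mathbf F_\pi}(\mathcal O,K)\subset C(\mathcal O,K)$ the subspace of continuous $\mathbf F_\pi$-linear maps. A sequence $(e_n)_{n\ge 0}$ in a normed $K$-vector space $E$ is called an orthonormal basis of $E$ if each $x\in E$ has a unique representation $x=\sum_{n\ge 0}c_ne_n$ with $c_n\in K$, $c_n\to 0$, and this representation satisfies $\|x\|=\max_{n}|c_n|$. For $j\ge 0$ let $\mathcal D_{j,T}\colon\mathbf F_r[T]\to\mathbf F_r[T]$ be the $\mathbf F_r$-linear map with $\mathcal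 D_{j,T}(T^m)=\binom mj T^{m-j}$ for $m\ge 0$ (read as $0$ when $m<j$). Then: (1) each $\mathcal D_{j,T}$ has a unique extension to a continuous function $\mathcal O\to K$, again denoted $\mathcal D_{j,T}$; (2) the extended functions $\mathcal D_{j,T}$ are $\mathbf F_\pi$-linear, and $(\mathcal D_{j,T})_{j\ge 0}$ is an orthonormal basis of $\operatorname{Hom}_{\mathbf F_\pi}(\mathcal O,K)$; (3) writing $i\ge 0$ in base $r^d$ as $i=c_0+c_1r^d+\dots+c_{n-1}r^{d(n-1)}$ with $0\le c_j\le r^d-1$, the pointwise products $\mathbf D_i=\mathcal D_{0,T}^{c_0}\mathcal D_{1,T}^{c_1}\cdots\mathcal D_{n-1,T}^{c_{n-1}}$ (where a $0$-th power is the constant function $1$), $i\ge 0$, form an orthonormal basis of $C(\mathcal O,K)$. -/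

import Mathlib

open Polynomial IsDedekindDomain Filter Topology WithZero

noncomputable section

namespace Hyperdiff

/-- A sequence `e` in a Banach space `E` over a valued field `K` is an *orthonormal basis* if every
`x : E` has a unique representation `x = ∑ cₙ eₙ` with `cₙ ∈ K`, `cₙ → 0`, and moreover
`‖x‖ = max ‖cₙ‖` for it. -/
def IsOrthonormalBasis (K : Type*) {E : Type*} [NormedField K] [NormedAddCommGroup E]
    [NormedSpace K E] (e : ℕ → E) : Prop :=
  ∀ x : E, ∃ c : ℕ → K,
    Tendsto c atTop (𝓝 0) ∧ HasSum (fun n => c n • e n) x ∧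
    IsGreatest (Set.range fun n => ‖c n‖) ‖x‖ ∧
    ∀ c' : ℕ → K, Tendsto c' atTop (𝓝 0) → HasSum (fun n => c' n • e n) x → c' = c

/-- The extension of a sequence by `q`-digit expansions: for `i = c₀ + c₁ q + ⋯ + cₙ₋₁ qⁿ⁻¹` with
`0 ≤ cⱼ ≤ q - 1`, the `i`-th term is `e₀ ^ c₀ * e₁ ^ c₁ * ⋯ * eₙ₋₁ ^ cₙ₋₁`. -/
def digitExtension {A : Type*} [CommMonoid A] (q : ℕ) (e : ℕ → A) (i : ℕ) : A :=
  ∏ j ∈ Finset.range (Nat.digits q i).length, e j ^ (Nat.digits q i).getD j 0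

section Local

variable {F : Type*} [Field F] [Fintype F] (π : F[X]) (hπ : Irreducible π)

/-- The place of `F(T)` attached to an irreducible polynomial `π`. -/
def place {F : Type*} [Field F] (π : F[X]) (hπ : Irreducible π) : HeightOneSpectrum F[X] where
  asIdeal := Ideal.span {π}
  isPrime := (Ideal.span_singleton_prime hπ.ne_zero).2 hπ.prime
  ne_bot := by simpa using hπ.ne_zero

/-- The completion `K` of `F(T)` at `π`. -/
abbrev LocalField {F : Type*} [Field F] (π : F[X]) (hπ : Irreducible π) : Type _ :=
  (place π hπ).adicCompletion (RatFunc F)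

/-- The completion `𝓞` of `F[T]` at `π`, the ring of integers of `LocalField π hπ`. -/
abbrev LocalInt {F : Type*} [Field F] (π : F[X]) (hπ : Irreducible π) : Type _ :=
  (place π hπ).adicCompletionIntegers (RatFunc F)

lemma one_lt_base (hπ : Irreducible π) :
    (1 : NNReal) < ((Fintype.card F ^ π.natDegree : ℕ) : NNReal) := by
  exact_mod_cast Nat.one_lt_pow hπ.natDegree_pos.ne' Fintype.one_lt_card

/-- The valuation of `K`, as a real number: the normalised absolute value, with
`|π| = (r ^ d)⁻¹` for `r = #F`, `d = deg π`. -/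
instance rankOne : (Valued.v : Valuation (LocalField π hπ) ℤᵐ⁰).RankOne :=
  Valuation.IsRankOneDiscrete.rankOne _ (one_lt_base π hπ)

instance normedField : NontriviallyNormedField (LocalField π hπ) :=
  Valued.toNontriviallyNormedField (LocalField π hπ) ℤᵐ⁰

/-- Elements of `F[T]` are dense in `𝓞`, to first order. -/
lemma exists_close {F : Type*} [Field F] (π : F[X]) (hπ : Irreducible π) (x : LocalInt π hπ) :
    ∃ a : F[X], Valued.v ((x : LocalField π hπ) - algebraMap F[X] (LocalField π hπ) a) < 1 := by
  set v := place π hπ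
  have hx : Valued.v (x : LocalField π hπ) ≤ 1 := x.2
  obtain ⟨k, hk⟩ : ∃ k : RatFunc F,
      Valued.v ((x : LocalField π hπ) - algebraMap (RatFunc F) (LocalField π hπ) k) < 1 := by
    have hd := HeightOneSpectrum.denseRange_algebraMap (K := RatFunc F) (v := v)
    have ho : {y : LocalField π hπ | Valued.v ((x : LocalField π hπ) - y) < 1} ∈
        𝓝 (x : LocalField π hπ) := by
      rw [Valued.mem_nhds]
      refine ⟨1, fun y hy => ?_⟩
      simp only [Set.mem_ofPred_eq] at hy ⊢
      rw [Valuation.map_sub_swap]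
      simpa using hy
    obtain ⟨y, hy⟩ := hd.mem_nhds ho
    exact ⟨y, hy⟩
  have hk1 : v.valuation (RatFunc F) k ≤ 1 := by
    rw [← HeightOneSpectrum.valuedAdicCompletion_eq_valuation']
    have : ((k : RatFunc F) : v.adicCompletion (RatFunc F)) =
        (x : LocalField π hπ) - ((x : LocalField π hπ) -
          algebraMap (RatFunc F) (LocalField π hπ) k) := by
      rw [sub_sub_cancel]; rfl
    rw [this]
    exact (Valuation.map_sub _ _ _).trans (max_le hx hk.le)
  obtain ⟨a, ha⟩ := v.exists_valuation_sub_lt_of_integer hk1 1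
  refine ⟨a, ?_⟩
  have h2 : Valued.v (algebraMap (RatFunc F) (LocalField π hπ) k -
      algebraMap F[X] (LocalField π hπ) a) < 1 := by
    rw [IsScalarTower.algebraMap_apply F[X] (RatFunc F) (LocalField π hπ), ← map_sub]
    have := HeightOneSpectrum.valuedAdicCompletion_eq_valuation' (v := v)
      (k - algebraMap F[X] (RatFunc F) a)
    refine lt_of_eq_of_lt this ?_
    rw [Valuation.map_sub_swap]
    simpa using ha
  rw [← sub_add_sub_cancel _ (algebraMap (RatFunc F) (LocalField π hπ) k)]
  exact Valuation.map_add_lt _ hk h2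

open Valued in
instance compactSpace : CompactSpace (LocalInt π hπ) := by
  have hfin : Finite (F[X] ⧸ Ideal.span {π}) := by
    have : Module.Finite F (AdjoinRoot π) := (AdjoinRoot.powerBasis hπ.ne_zero).finite
    exact Module.finite_of_finite F (M := AdjoinRoot π)
  have hmem : ∀ a : F[X], algebraMap F[X] (LocalField π hπ) a ∈ 𝒪[LocalField π hπ] :=
    fun a => (place π hπ).coe_mem_adicCompletionIntegers a
  let g : F[X] →+* 𝒪[LocalField π hπ] := (algebraMap F[X] (LocalField π hπ)).codRestrict _ hmem
  let φ : F[X] →+* 𝓀[LocalField π hπ] := (IsLocalRing.residue _).comp g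
  have hφ : ∀ x y : 𝒪[LocalField π hπ], Valued.v ((x : LocalField π hπ) - y) < 1 →
      IsLocalRing.residue _ x = IsLocalRing.residue _ y := by
    intro x y h
    rw [← sub_eq_zero, ← map_sub, IsLocalRing.residue_eq_zero_iff]
    exact (Valuation.mem_maximalIdeal_iff _ (Valued.v : Valuation (LocalField π hπ) ℤᵐ⁰)).2 h
  have hφπ : ∀ a ∈ Ideal.span {π}, φ a = 0 := by
    intro a ha
    refine (hφ (g a) 0 ?_).trans (map_zero _)
    have h1 := (place π hπ).valuedAdicCompletion_eq_valuation (K := RatFunc F) a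
    have h2 := ((place π hπ).valuation_lt_one_iff_mem (K := RatFunc F) a).2 ha
    rw [ZeroMemClass.coe_zero, sub_zero]
    exact lt_of_eq_of_lt h1 h2
  have hres : Finite 𝓀[LocalField π hπ] := by
    refine Finite.of_surjective (Ideal.Quotient.lift _ φ hφπ) fun y => ?_
    obtain ⟨x, rfl⟩ := IsLocalRing.residue_surjective y
    obtain ⟨a, ha⟩ := exists_close π hπ x
    exact ⟨Ideal.Quotient.mk _ a, (hφ x (g a) ha).symm⟩
  have hdvr : IsDiscreteValuationRing 𝒪[LocalField π hπ] :=
    inferInstanceAs (IsDiscreteValuationRing (LocalInt π hπ))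
  have hcomp : CompleteSpace 𝒪[LocalField π hπ] :=
    (Valued.isClosed_integer (LocalField π hπ)).completeSpace_coe
  exact Valued.integer.compactSpace_iff_completeSpace_and_isDiscreteValuationRing_and_finite_residueField.2
    ⟨hcomp, hdvr, hres⟩

/-- The coefficient field of `𝓞`, i.e. the canonical copy `F_π ⊆ 𝓞` of the residue field (which has
`q = r ^ d` elements): the set of solutions of `a ^ q = a` in `𝓞`. -/
def coeffField : Subring (LocalInt π hπ) :=
  have hq : ∃ p n : ℕ, ∃ _ : Fact p.Prime, CharP (LocalInt π hπ) p ∧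
      Fintype.card F ^ π.natDegree = p ^ n := by
    obtain ⟨p, hF, n, hp, hn⟩ := FiniteField.card' F
    refine ⟨p, n * π.natDegree, ⟨hp⟩, ?_, by rw [hn, pow_mul]⟩
    have hinj : Function.Injective ((algebraMap F[X] (LocalInt π hπ)).comp C) :=
      (FaithfulSMul.algebraMap_injective F[X] (LocalInt π hπ)).comp C_injective
    exact charP_of_injective_ringHom hinj p
  { carrier := {a | a ^ (Fintype.card F ^ π.natDegree) = a}
    mul_mem' := fun {a b} ha hb => by
      simp only [Set.mem_ofPred_eq] at *
      rw [mul_pow, ha, hb]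
    one_mem' := one_pow _
    add_mem' := fun {a b} ha hb => by
      obtain ⟨p, n, hp, hc, h⟩ := hq
      simp only [Set.mem_ofPred_eq, h] at *
      rw [add_pow_char_pow, ha, hb]
    zero_mem' := zero_pow (pow_pos Fintype.card_pos _).ne'
    neg_mem' := fun {a} ha => by
      obtain ⟨p, n, hp, hc, h⟩ := hq
      simp only [Set.mem_ofPred_eq, h] at *
      have := sub_pow_char_pow (R := LocalInt π hπ) (p := p) (n := n) 0 a
      rwa [zero_pow (pow_pos hp.out.pos n).ne', zero_sub, zero_sub, ha] at this }

/-- `Hom_{F_π}(𝓞, K)`: the space of continuous `F_π`-linear maps `𝓞 → K`, as a subspace of the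
Banach space `C(𝓞, K)` with its sup-norm. -/
def linearMaps : Submodule (LocalField π hπ) C(LocalInt π hπ, LocalField π hπ) where
  carrier := {f | IsLinearMap (coeffField π hπ) f}
  add_mem' := fun {f g} hf hg =>
    { map_add := fun x y => by
        simp only [ContinuousMap.add_apply, hf.map_add, hg.map_add]; abel
      map_smul := fun a x => by
        simp only [ContinuousMap.add_apply, hf.map_smul, hg.map_smul, smul_add] }
  zero_mem' :=
    { map_add := fun x y => by simp
      map_smul := fun a x => by simp }
  smul_mem' := fun c f hf =>
    { map_add := fun x y => by simp only [ContinuousMap.smul_apply, hf.map_add, smul_add]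
      map_smul := fun a x => by
        simp only [ContinuousMap.smul_apply, hf.map_smul]; exact smul_comm c a (f x) }

/-- `D j` is, for every `j`, a continuous function `𝓞 → K` extending the `j`-th hyperdifferential
operator `T ^ m ↦ (m choose j) T ^ (m - j)` of `F[T]`. -/
def ExtendsHyperdiff (D : ℕ → C(LocalInt π hπ, LocalField π hπ)) : Prop :=
  ∀ (j : ℕ) (f : F[X]), D j (algebraMap F[X] (LocalInt π hπ) f) =
    algebraMap F[X] (LocalField π hπ) (hasseDeriv j f)

end Local

end Hyperdiff

end

/-! Everything is read off modulo the maximal ideal. Over a discretely valued field, a sequence of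
functions with integral values is an orthonormal basis once two things hold: an integral combination
with a unit coefficient does not vanish identically modulo the maximal ideal, and every integral
function in the space agrees modulo it with a finite combination. Successive approximation does the
rest (`isOrthonormalBasis_of_approx`, `isOrthonormalBasis_of_linearIsometry`).

The operator `hasseDeriv j` loses at most `j` factors of `π` (`pow_sub_dvd_hasseDeriv`), so it
extends continuously to `𝓞`; by density the extensions form a higher derivation `Δ`. As `F` is
perfect, `π` is separable, so `Δ 1 π = π'` is a unit. Leibniz then makes the residues triangular: `Δ
j (π ^ m * x)` is `0` for `j < m` and `π' ^ m * x` for `j = m` (`residue_pow_mul`). Hence `Δ 0, …, Δ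
(n - 1)` identify `𝓞 / π ^ n` with `k ^ n`, where `k` is the residue field, of order `q = r ^ d`.

A continuous integral function reduces to a function on some `k ^ N`, and the monomials with
exponents below `q` are a basis of these; this gives the digit products. A linear function is
determined modulo the maximal ideal by its values at the `π ^ n`, and the matrix `Δ j (π ^ n)` is
triangular with unit diagonal; this gives the basis of linear maps. The `Δ j` are themselves linear
because `a ^ q = a` forces `Δ j a = 0` for `j > 0`. -/

namespace Hyperdiff

/-! ### Orthonormal bases by successive approximation. -/

section Criterion

variable {K E : Type*} [NormedField K] [NormedAddCommGroup E] [NormedSpace K E]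

lemma norm_sub_le_max' [IsUltrametricDist E] (x y : E) : ‖x - y‖ ≤ max ‖x‖ ‖y‖ := by
  simpa [sub_eq_add_neg] using IsUltrametricDist.norm_add_le_max x (-y)

/-- A null sequence in a normed space has a term of maximal norm. -/
lemma exists_norm_max_of_tendsto_zero {c : ℕ → K} (hc : Tendsto c atTop (𝓝 0)) :
    ∃ m, ∀ n, ‖c n‖ ≤ ‖c m‖ := by
  by_cases h : ∀ n, c n = 0
  · exact ⟨0, fun n => by simp [h]⟩
  push Not at h
  obtain ⟨n₀, hn₀⟩ := h
  have hev := (tendsto_zero_iff_norm_tendsto_zero.1 hc).eventually_lt_const (norm_pos_iff.2 hn₀)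
  obtain ⟨N, hN⟩ := eventually_atTop.1 hev
  obtain ⟨m, -, hm⟩ := (Finset.range (N + n₀ + 1)).exists_max_image (fun n => ‖c n‖) ⟨n₀, by simp⟩
  refine ⟨m, fun n => ?_⟩
  by_cases hn : n < N + n₀ + 1
  · exact hm n (by simpa using hn)
  · exact (hN n (by omega)).le.trans (hm n₀ (by simp))

/-- Lets hypotheses on finitely supported coefficients be applied to partial sums of a series. -/
lemma linearCombination_indicator (e : ℕ → E) (c : ℕ → K) (T : Finset ℕ) :
    Finsupp.linearCombination K e (Finsupp.indicator T fun n _ => c n) = ∑ n ∈ T, c n • e n := by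
  rw [Finsupp.linearCombination_apply, Finsupp.sum_of_support_subset _
    (Finsupp.support_indicator_subset _ _) _ (by simp)]
  exact Finset.sum_congr rfl fun n hn => by rw [Finsupp.indicator_of_mem hn]

lemma norm_linearCombination_le [IsUltrametricDist E] {e : ℕ → E} (he : ∀ n, ‖e n‖ ≤ 1)
    (s : ℕ →₀ K) {C : ℝ} (hC : 0 ≤ C) (hs : ∀ n, ‖s n‖ ≤ C) :
    ‖Finsupp.linearCombination K e s‖ ≤ C := by
  rw [Finsupp.linearCombination_apply, Finsupp.sum]
  refine IsUltrametricDist.norm_sum_le_of_forall_le_of_nonneg hC fun n _ => ?_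
  rw [norm_smul]
  exact (mul_le_of_le_one_right (norm_nonneg _) (he n)).trans (hs n)

/-- A sequence whose finite linear combinations have norm at least that of each coefficient, and
approximate every vector up to a fixed factor `ρ < 1`, is an orthonormal basis. -/
theorem isOrthonormalBasis_of_approx [CompleteSpace K] [IsUltrametricDist E] {e : ℕ → E}
    (he : ∀ n, ‖e n‖ ≤ 1)
    (h1 : ∀ (s : ℕ →₀ K) (n : ℕ), ‖s n‖ ≤ ‖Finsupp.linearCombination K e s‖)
    {ρ : ℝ} (hρ0 : 0 ≤ ρ) (hρ : ρ < 1)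
    (h2 : ∀ x : E, ∃ s : ℕ →₀ K, ‖x - Finsupp.linearCombination K e s‖ ≤ ρ * ‖x‖) :
    IsOrthonormalBasis K e := by
  intro x
  have hsum : ∀ (c : ℕ → K) (y : E), HasSum (fun n => c n • e n) y → ∀ n, ‖c n‖ ≤ ‖y‖ := by
    intro c y hy n
    refine ge_of_tendsto hy.norm (eventually_atTop.2 ⟨{n}, fun T hT => ?_⟩)
    have := h1 (Finsupp.indicator T fun n _ => c n) n
    rwa [linearCombination_indicator, Finsupp.indicator_of_mem (hT (by simp))] at this
  have hpow : ∀ k : ℕ, ∃ s : ℕ →₀ K, ‖x - Finsupp.linearCombination K e s‖ ≤ ρ ^ k * ‖x‖ := by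
    intro k
    induction k with
    | zero => exact ⟨0, by simp⟩
    | succ k ih =>
      obtain ⟨s, hs⟩ := ih
      obtain ⟨t, ht⟩ := h2 (x - Finsupp.linearCombination K e s)
      refine ⟨s + t, ?_⟩
      rw [map_add, ← sub_sub]
      refine ht.trans ((mul_le_mul_of_nonneg_left hs hρ0).trans_eq ?_)
      ring
  choose s hs using hpow
  set b : ℕ → ℝ := fun k => ρ ^ k * ‖x‖ with hb
  have hb0 : ∀ k, 0 ≤ b k := fun k => by positivity
  have hbt : Tendsto b atTop (𝓝 0) := by
    simpa using (tendsto_pow_atTop_nhds_zero_of_lt_one hρ0 hρ).mul_const ‖x‖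
  have hanti : ∀ k l, k ≤ l → b l ≤ b k := fun k l h =>
    mul_le_mul_of_nonneg_right (pow_le_pow_of_le_one hρ0 hρ.le h) (norm_nonneg _)
  -- The bound `h1` on coefficients of `s l - s k` makes the approximations Cauchy in each
  -- coefficient, uniformly in `n`.
  have hdiff : ∀ k l, k ≤ l → ∀ n, ‖s l n - s k n‖ ≤ b k := by
    intro k l hkl n
    rw [← Finsupp.sub_apply]
    refine (h1 _ n).trans ?_
    rw [map_sub, ← sub_sub_sub_cancel_left _ _ x]
    exact (norm_sub_le_max' _ _).trans
      (max_le (hs k) ((hs l).trans (hanti k l hkl)))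
  have hlim : ∀ n, ∃ c : K, Tendsto (fun k => s k n) atTop (𝓝 c) := by
    intro n
    refine cauchySeq_tendsto_of_complete (cauchySeq_of_le_tendsto_0' b (fun k l hkl => ?_) hbt)
    rw [dist_comm, dist_eq_norm]
    exact hdiff k l hkl n
  choose c hc using hlim
  have hcs : ∀ k n, ‖c n - s k n‖ ≤ b k := fun k n =>
    le_of_tendsto ((hc n).sub_const _).norm
      (eventually_atTop.2 ⟨k, fun l hl => hdiff k l hl n⟩)
  have hc0 : Tendsto c atTop (𝓝 0) := by
    rw [Metric.tendsto_atTop]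
    intro ε hε
    obtain ⟨k, hk⟩ := (hbt.eventually_lt_const hε).exists
    -- Beyond the support of `s k`, the bound `‖c n - s k n‖ ≤ b k` is a bound on `c n` itself.
    refine ⟨(s k).support.sup id + 1, fun n hn => ?_⟩
    have hn' : s k n = 0 := by
      by_contra h
      have := Finset.le_sup (f := id) (Finsupp.mem_support_iff.2 h)
      simp only [id] at this
      omega
    have := hcs k n
    rw [hn', sub_zero] at this
    rw [dist_zero_right]
    exact this.trans_lt hk
  have hxs : HasSum (fun n => c n • e n) x := by
    rw [HasSum, SummationFilter.unconditional_filter, Metric.tendsto_atTop]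
    intro ε hε
    obtain ⟨k, hk⟩ := (hbt.eventually_lt_const hε).exists
    -- For `T` containing this support, the partial sum over `T` and the combination `s k` differ by
    -- coefficients of norm at most `b k`.
    refine ⟨(s k).support, fun T hT => ?_⟩
    rw [dist_comm, dist_eq_norm]
    refine lt_of_le_of_lt ?_ hk
    rw [← linearCombination_indicator,
      ← sub_sub_sub_cancel_right _ _ (Finsupp.linearCombination K e (s k)), ← map_sub]
    refine (norm_sub_le_max' _ _).trans (max_le (hs k) ?_)
    refine norm_linearCombination_le he _ (hb0 k) fun n => ?_
    rw [Finsupp.sub_apply]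
    by_cases hn : n ∈ T
    · rw [Finsupp.indicator_of_mem hn]
      exact hcs k n
    · rw [Finsupp.indicator_of_notMem hn, Finsupp.notMem_support_iff.1 fun h => hn (hT h)]
      simpa using hb0 k
  obtain ⟨m, hm⟩ := exists_norm_max_of_tendsto_zero hc0
  refine ⟨c, hc0, hxs, ⟨⟨m, le_antisymm (hsum c x hxs m) ?_⟩, ?_⟩, fun c' _ hc' => ?_⟩
  · refine le_of_tendsto hxs.norm (Eventually.of_forall fun T => ?_)
    rw [← linearCombination_indicator]
    refine norm_linearCombination_le he _ (norm_nonneg _) fun n => ?_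
    by_cases hn : n ∈ T
    · rw [Finsupp.indicator_of_mem hn]
      exact hm n
    · rw [Finsupp.indicator_of_notMem hn]
      simp
  · rintro _ ⟨n, rfl⟩
    exact hsum c x hxs n
  · funext n
    have h := hc'.sub hxs
    simp only [← sub_smul, sub_self] at h
    have := hsum (fun n => c' n - c n) 0 h n
    rw [norm_zero, norm_le_zero_iff] at this
    exact sub_eq_zero.1 this

end Criterion

/-! ### Normalisation in function spaces on a compact space. -/

section FunctionSpace

variable {X K : Type*} [TopologicalSpace X] [CompactSpace X] [NormedField K] [IsUltrametricDist K]

instance isUltrametricDist_continuousMap : IsUltrametricDist C(X, K) :=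
  IsUltrametricDist.isUltrametricDist_of_forall_norm_add_le_max_norm fun f g =>
    (ContinuousMap.norm_le _ (le_max_of_le_left (norm_nonneg _))).2 fun x =>
      (IsUltrametricDist.norm_add_le_max (f x) (g x)).trans
        (max_le_max (f.norm_coe_le_norm x) (g.norm_coe_le_norm x))

/-- For a space of functions on a compact space, both conditions of `isOrthonormalBasis_of_approx`
need only be checked for combinations with integral coefficients, some of which is a unit, and for
functions bounded by `1`. -/
theorem isOrthonormalBasis_of_linearIsometry [CompleteSpace K] [Nonempty X] {E : Type*}
    [NormedAddCommGroup E] [NormedSpace K E] (L : E →ₗᵢ[K] C(X, K))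
    {e : ℕ → E} (he : ∀ n x, ‖L (e n) x‖ ≤ 1)
    (h1 : ∀ s : ℕ →₀ K, (∀ n, ‖s n‖ ≤ 1) → (∃ n, ‖s n‖ = 1) →
      ∃ x, 1 ≤ ‖L (Finsupp.linearCombination K e s) x‖)
    {θ : ℝ} (hθ0 : 0 ≤ θ) (hθ : θ < 1)
    (h2 : ∀ f : E, (∀ x, ‖L f x‖ ≤ 1) →
      ∃ s : ℕ →₀ K, ∀ x, ‖L f x - L (Finsupp.linearCombination K e s) x‖ ≤ θ) :
    IsOrthonormalBasis K e := by
  have : IsUltrametricDist E :=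
    IsUltrametricDist.isUltrametricDist_of_forall_norm_add_le_max_norm fun f g => by
      rw [← L.norm_map, ← L.norm_map f, ← L.norm_map g, map_add]
      exact IsUltrametricDist.norm_add_le_max _ _
  refine isOrthonormalBasis_of_approx (fun n => ?_) (fun s n => ?_) hθ0 hθ fun f => ?_
  · rw [← L.norm_map]
    exact (ContinuousMap.norm_le _ zero_le_one).2 (he n)
  · by_cases hs : s = 0
    · simp [hs]
    obtain ⟨m, hm, hmax⟩ := s.support.exists_max_image (fun n => ‖s n‖)
      (Finsupp.support_nonempty_iff.2 hs)
    rw [Finsupp.mem_support_iff] at hm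
    have hmax' : ∀ n, ‖s n‖ ≤ ‖s m‖ := by
      intro n
      by_cases hn : s n = 0
      · simp [hn]
      · exact hmax n (Finsupp.mem_support_iff.2 hn)
    have hm0 : 0 < ‖s m‖ := norm_pos_iff.2 hm
    -- Dividing by a coefficient of maximal norm makes all coefficients integral and one a unit.
    obtain ⟨x, hx⟩ := h1 ((s m)⁻¹ • s)
      (fun n => by
        rw [Finsupp.smul_apply, norm_smul, norm_inv, inv_mul_le_iff₀ hm0, mul_one]
        exact hmax' n)
      ⟨m, by rw [Finsupp.smul_apply, smul_eq_mul, inv_mul_cancel₀ hm, norm_one]⟩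
    rw [map_smul, map_smul, ContinuousMap.smul_apply, norm_smul, norm_inv,
      le_inv_mul_iff₀ hm0, mul_one] at hx
    rw [← L.norm_map]
    exact (hmax' n).trans (hx.trans (ContinuousMap.norm_coe_le_norm _ x))
  · by_cases hf : f = 0
    · exact ⟨0, by simp [hf]⟩
    -- By compactness the sup-norm is the norm of a scalar, so `f` can be rescaled to norm exactly
    -- `1`.
    obtain ⟨x₀, hx₀⟩ : ∃ x₀, ‖L f x₀‖ = ‖f‖ := by
      obtain ⟨x₀, -, hx₀⟩ := isCompact_univ.exists_isMaxOn Set.univ_nonempty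
        (L f).continuous.norm.continuousOn
      rw [← L.norm_map]
      refine ⟨x₀, le_antisymm (ContinuousMap.norm_coe_le_norm _ x₀) ?_⟩
      exact (ContinuousMap.norm_le _ (norm_nonneg _)).2 fun x => hx₀ (Set.mem_univ x)
    have hf0 : 0 < ‖f‖ := norm_pos_iff.2 hf
    set a := L f x₀
    have ha : a ≠ 0 := norm_pos_iff.1 (hx₀ ▸ hf0)
    obtain ⟨s, hs⟩ := h2 (a⁻¹ • f) fun x => by
      rw [map_smul, ContinuousMap.smul_apply, norm_smul, norm_inv, hx₀,
        inv_mul_le_iff₀ hf0, mul_one, ← L.norm_map]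
      exact ContinuousMap.norm_coe_le_norm _ x
    refine ⟨a • s, ?_⟩
    have h3 : ‖a⁻¹ • f - Finsupp.linearCombination K e s‖ ≤ θ := by
      rw [← L.norm_map, map_sub]
      exact (ContinuousMap.norm_le _ hθ0).2 hs
    have h4 : f - Finsupp.linearCombination K e (a • s) =
        a • (a⁻¹ • f - Finsupp.linearCombination K e s) := by
      rw [map_smul, smul_sub, smul_inv_smul₀ ha]
    rw [h4, norm_smul, hx₀, mul_comm]
    exact mul_le_mul_of_nonneg_right h3 hf0.le

end FunctionSpace
end Hyperdiff

namespace Hyperdiff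

/-! ### Monomials with exponents below `q` as functions on `k ^ n`. -/

section Digits

/-- Leading zero digits contribute factors `v j ^ 0 = 1`, so all `i < q ^ n` can share one index
range. -/
lemma digitExtension_eq_prod {A : Type*} [CommMonoid A] {q n i : ℕ} (hq : 2 ≤ q) (hi : i < q ^ n)
    (v : ℕ → A) : digitExtension q v i = ∏ j ∈ Finset.range n, v j ^ (i / q ^ j % q) := by
  have hlen : (Nat.digits q i).length ≤ n := (Nat.digits_length_le_iff (by omega) i).2 hi
  rw [digitExtension]
  simp only [Nat.getD_digits _ _ hq]
  refine Finset.prod_subset (Finset.range_mono hlen) fun j _ hj => ?_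
  rw [Finset.mem_range, not_lt] at hj
  have : i < q ^ j := (Nat.digits_length_le_iff (by omega) i).1 hj
  simp [Nat.div_eq_of_lt this]

/-- Ensures that distinct indices give distinct exponent vectors, hence distinct monomials. -/
lemma eq_of_digits_eq {q : ℕ} : ∀ {n i i' : ℕ}, i < q ^ n → i' < q ^ n →
    (∀ j < n, i / q ^ j % q = i' / q ^ j % q) → i = i'
  | 0, i, i', hi, hi', _ => by simp at hi hi'; omega
  | n + 1, i, i', hi, hi', h => by
    have h0 : i % q = i' % q := by simpa using h 0 (by omega)
    have h1 : i / q = i' / q := by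
      refine eq_of_digits_eq (n := n) (Nat.div_lt_of_lt_mul (by rwa [pow_succ'] at hi))
        (Nat.div_lt_of_lt_mul (by rwa [pow_succ'] at hi')) fun j hj => ?_
      rw [Nat.div_div_eq_div_mul, Nat.div_div_eq_div_mul, ← pow_succ']
      exact h (j + 1) (by omega)
    rw [← Nat.div_add_mod i q, ← Nat.div_add_mod i' q, h0, h1]

variable {k : Type*} [Field k] [Fintype k] {q : ℕ}

/-- The monomials with all exponents less than `q = #k` are linearly independent as functions. -/
lemma digitExtension_linearIndependent (hq : Fintype.card k = q) {n : ℕ} {c : ℕ → k}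
    (h : ∀ v : ℕ → k, ∑ i ∈ Finset.range (q ^ n), c i * digitExtension q v i = 0) :
    ∀ i < q ^ n, c i = 0 := by
  have hq2 : 2 ≤ q := hq ▸ Fintype.one_lt_card
  let m : ℕ → Fin n →₀ ℕ := fun i => Finsupp.equivFunOnFinite.symm fun j => i / q ^ (j : ℕ) % q
  let P : MvPolynomial (Fin n) k := ∑ i ∈ Finset.range (q ^ n), MvPolynomial.monomial (m i) (c i)
  have hP : P = 0 := by
    -- A polynomial of degree less than `#k` in each variable that vanishes on `k ^ n` is zero; the
    -- exponents are base `q` digits, so the degree bound holds.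
    refine MvPolynomial.eq_zero_of_eval_zero_at_prod_finset P (fun _ => Finset.univ) ?_
      fun v _ => ?_
    rotate_left
    · rw [← h fun j => if hj : j < n then v ⟨j, hj⟩ else 0, map_sum]
      refine Finset.sum_congr rfl fun i hi => ?_
      rw [MvPolynomial.eval_monomial, digitExtension_eq_prod hq2 (Finset.mem_range.1 hi),
        ← Fin.prod_univ_eq_prod_range
          (fun j => (if hj : j < n then v ⟨j, hj⟩ else 0) ^ (i / q ^ j % q)),
        Finsupp.prod_fintype _ _ (by simp)]
      simp [m]
    · intro j
      rw [Finset.card_univ, hq, MvPolynomial.degreeOf_lt_iff (by omega)]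
      intro s hs
      obtain ⟨i, -, hi⟩ := Finset.mem_biUnion.1 (MvPolynomial.support_sum hs)
      rw [Finset.mem_singleton.1 (MvPolynomial.support_monomial_subset hi)]
      exact Nat.mod_lt _ (by omega)
  intro i hi
  have hc := congrArg (MvPolynomial.coeff (m i)) hP
  rw [MvPolynomial.coeff_sum, Finset.sum_eq_single i, MvPolynomial.coeff_monomial, if_pos rfl,
    MvPolynomial.coeff_zero] at hc
  · exact hc
  · intro i' hi' hne
    rw [MvPolynomial.coeff_monomial, if_neg]
    intro hm
    refine hne (eq_of_digits_eq (Finset.mem_range.1 hi') hi fun j hj => ?_)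
    simpa [m] using DFunLike.congr_fun hm ⟨j, hj⟩
  · intro h'
    exact absurd (Finset.mem_range.2 hi) h'

/-- Every function on `k ^ n` is a combination of monomials with exponents less than `q = #k`. -/
lemma exists_eq_sum_digitExtension (hq : Fintype.card k = q) {n : ℕ} (w : (Fin n → k) → k) :
    ∃ c : ℕ → k, ∀ v : ℕ → k,
      w (fun j => v j) = ∑ i ∈ Finset.range (q ^ n), c i * digitExtension q v i := by
  have hq2 : 2 ≤ q := hq ▸ Fintype.one_lt_card
  let ext : (Fin n → k) → ℕ → k := fun v j => if hj : j < n then v ⟨j, hj⟩ else 0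
  have hext : ∀ (v : ℕ → k), ∀ i < q ^ n,
      digitExtension q (ext fun j => v j) i = digitExtension q v i := by
    intro v i hi
    rw [digitExtension_eq_prod hq2 hi, digitExtension_eq_prod hq2 hi]
    refine Finset.prod_congr rfl fun j hj => ?_
    simp [ext, Finset.mem_range.1 hj]
  let T : (Fin (q ^ n) → k) →ₗ[k] ((Fin n → k) → k) :=
    Fintype.linearCombination k fun i v => digitExtension q (ext v) (i : ℕ)
  have hT : ∀ c v, T c v = ∑ i, c i * digitExtension q (ext v) (i : ℕ) := by
    intro c v
    simp [T, Fintype.linearCombination_apply]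
  have hinj : Function.Injective T := by
    rw [injective_iff_map_eq_zero]
    intro c hc
    funext i
    have h := digitExtension_linearIndependent (k := k) hq (n := n)
      (c := fun i => if hi : i < q ^ n then c ⟨i, hi⟩ else 0) (fun v => ?_) i i.2
    · simpa using h
    · have h := congrFun hc fun j => v j
      rw [hT] at h
      rw [← Fin.sum_univ_eq_sum_range (fun i => (if hi : i < q ^ n then c ⟨i, hi⟩ else 0) *
        digitExtension q v i)]
      simpa [hext] using h
  -- Both sides have dimension `q ^ n`.
  have hsurj : Function.Surjective T := by
    refine (LinearMap.injective_iff_surjective_of_finrank_eq_finrank ?_).1 hinj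
    simp [hq]
  obtain ⟨c, hc⟩ := hsurj w
  refine ⟨fun i => if hi : i < q ^ n then c ⟨i, hi⟩ else 0, fun v => ?_⟩
  rw [← hc, hT, ← Fin.sum_univ_eq_sum_range (fun i => (if hi : i < q ^ n then c ⟨i, hi⟩ else 0) *
        digitExtension q v i)]
  simp [hext]

end Digits

/-! ### Residues of a higher derivation as coordinates modulo `ϖ ^ n`. -/

section HasseDerivations

open Finset.HasAntidiagonal

variable {R k : Type*} [CommRing R] [Field k] {Δ : ℕ → R →+ R} {ρ : R →+* k} {ϖ : R}

/-- A higher derivation `Δ` of a ring `R` with principal maximal ideal `(ϖ)` and residue map `ρ`,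
such that `Δ 1 ϖ` is a unit. -/
structure IsUnramifiedHigherDerivation (Δ : ℕ → R →+ R) (ρ : R →+* k) (ϖ : R) : Prop where
  zero_apply : ∀ x, Δ 0 x = x
  leibniz : ∀ n x y, Δ n (x * y) = ∑ ij ∈ antidiagonal n, Δ ij.1 x * Δ ij.2 y
  residue_eq_zero_iff : ∀ x, ρ x = 0 ↔ ϖ ∣ x
  residue_ne_zero : ρ (Δ 1 ϖ) ≠ 0
  surjective : Function.Surjective ρ

namespace IsUnramifiedHigherDerivation

variable (H : IsUnramifiedHigherDerivation Δ ρ ϖ)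
include H

/-- Modulo a uniformizer `ϖ`, a sequence of higher derivations is triangular with respect to powers
of `ϖ`. -/
lemma residue_pow_mul (m : ℕ) :
    (∀ j < m, ∀ x, ρ (Δ j (ϖ ^ m * x)) = 0) ∧
      ∀ x, ρ (Δ m (ϖ ^ m * x)) = ρ (Δ 1 ϖ) ^ m * ρ x := by
  have hϖ : ρ ϖ = 0 := (H.residue_eq_zero_iff ϖ).2 dvd_rfl
  induction m with
  | zero => simp [H.zero_apply]
  | succ m ih =>
    obtain ⟨ih1, ih2⟩ := ih
    have key : ∀ j ≤ m + 1, ∀ x, ρ (Δ j (ϖ ^ (m + 1) * x)) =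
        if j = m + 1 then ρ (Δ 1 ϖ) ^ (m + 1) * ρ x else 0 := by
      intro j hj x
      rw [pow_succ', mul_assoc, H.leibniz, map_sum]
      simp only [map_mul]
      split_ifs with h
      · subst h
        -- Terms with `a = 0` carry the factor `ρ ϖ = 0`, and those with `a ≥ 2` have `b < m`, where
        -- induction applies.
        rw [Finset.sum_eq_single (1, m)]
        · rw [ih2, pow_succ']
          ring
        · rintro ⟨a, b⟩ hab hne
          rw [mem_antidiagonal] at hab
          simp only at hab ⊢
          rcases Nat.eq_zero_or_pos a with rfl | ha
          · rw [H.zero_apply, hϖ, zero_mul]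
          · rw [ih1 b (by
              by_contra hb
              exact hne (by rw [Prod.mk.injEq]; omega)), mul_zero]
        · intro h
          exact absurd (mem_antidiagonal.2 (add_comm 1 m)) h
      · refine Finset.sum_eq_zero ?_
        rintro ⟨a, b⟩ hab
        rw [mem_antidiagonal] at hab
        simp only at hab ⊢
        rcases Nat.eq_zero_or_pos a with rfl | ha
        · rw [H.zero_apply, hϖ, zero_mul]
        · rw [ih1 b (by omega), mul_zero]
    refine ⟨fun j hj x => ?_, fun x => ?_⟩
    · rw [key j hj.le, if_neg hj.ne]
    · rw [key _ le_rfl, if_pos rfl]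

/-- By triangularity, adding `ϖ ^ n * u` adjusts the coordinate `n` freely without disturbing the
earlier ones. -/
lemma exists_residue_eq (v : ℕ → k) (n : ℕ) :
    ∃ x, ∀ j < n, ρ (Δ j x) = v j := by
  induction n with
  | zero => exact ⟨0, by simp⟩
  | succ n ih =>
    obtain ⟨x, hx⟩ := ih
    obtain ⟨u, hu⟩ := H.surjective ((v n - ρ (Δ n x)) / ρ (Δ 1 ϖ) ^ n)
    obtain ⟨h1, h2⟩ := H.residue_pow_mul n
    refine ⟨x + ϖ ^ n * u, fun j hj => ?_⟩
    rw [map_add, map_add]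
    rcases (Nat.lt_succ_iff_lt_or_eq.1 hj) with h | rfl
    · rw [h1 j h, hx j h, add_zero]
    · rw [h2, hu, mul_div_cancel₀ _ (pow_ne_zero _ H.residue_ne_zero), add_sub_cancel]

/-- On `ϖ ^ n * y` the coordinate `n` is a unit times the residue of `y`, so its vanishing yields
one more factor `ϖ`. -/
lemma pow_dvd_of_residue_eq_zero (n : ℕ) (x : R)
    (hx : ∀ j < n, ρ (Δ j x) = 0) : ϖ ^ n ∣ x := by
  induction n with
  | zero => simp
  | succ n ih =>
    obtain ⟨y, rfl⟩ := ih fun j hj => hx j (by omega)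
    obtain ⟨h1, h2⟩ := H.residue_pow_mul n
    have h := hx n (by omega)
    rw [h2, mul_eq_zero, or_iff_right (pow_ne_zero _ H.residue_ne_zero), H.residue_eq_zero_iff] at h
    rw [pow_succ]
    exact mul_dvd_mul_left _ h

/-- A function which is invariant under translation by `ϖ ^ n R` is a combination of the digit
products of the residues of the first `n` derivations. -/
lemma exists_eq_sum_digitExtension_residue [Fintype k] {q : ℕ} (hq : Fintype.card k = q) {n : ℕ}
    {g : R → k} (hg : ∀ x y, ϖ ^ n ∣ x - y → g x = g y) :
    ∃ c : ℕ → k, ∀ x, g x =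
      ∑ i ∈ Finset.range (q ^ n), c i * digitExtension q (fun j => ρ (Δ j x)) i := by
  have hfac : Function.FactorsThrough g fun x (j : Fin n) => ρ (Δ j x) := by
    intro x y hxy
    refine hg x y (H.pow_dvd_of_residue_eq_zero n _ ?_)
    intro j hj
    rw [map_sub, map_sub, sub_eq_zero]
    exact congrFun hxy ⟨j, hj⟩
  -- The default `0` of `Function.extend` is harmless: only values on the image of the coordinates
  -- are used.
  obtain ⟨c, hc⟩ := exists_eq_sum_digitExtension hq
    (Function.extend (fun x (j : Fin n) => ρ (Δ j x)) g 0)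
  refine ⟨c, fun x => ?_⟩
  rw [← hc fun j => ρ (Δ j x)]
  exact (hfac.extend_apply 0 x).symm

lemma digitExtension_residue_linearIndependent [Fintype k] {q : ℕ}
    (hq : Fintype.card k = q) {n : ℕ} {c : ℕ → k}
    (h : ∀ x, ∑ i ∈ Finset.range (q ^ n), c i * digitExtension q (fun j => ρ (Δ j x)) i = 0) :
    ∀ i < q ^ n, c i = 0 := by
  have hq2 : 2 ≤ q := hq ▸ Fintype.one_lt_card
  refine digitExtension_linearIndependent hq fun v => ?_
  obtain ⟨x, hx⟩ := H.exists_residue_eq v n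
  rw [← h x]
  refine Finset.sum_congr rfl fun i hi => ?_
  rw [digitExtension_eq_prod hq2 (Finset.mem_range.1 hi),
    digitExtension_eq_prod hq2 (Finset.mem_range.1 hi)]
  congr 1
  exact Finset.prod_congr rfl fun j hj => by rw [hx j (Finset.mem_range.1 hj)]

end IsUnramifiedHigherDerivation

end HasseDerivations
end Hyperdiff

namespace Hyperdiff

lemma map_digitExtension {A B G : Type*} [CommMonoid A] [CommMonoid B] [FunLike G A B]
    [MonoidHomClass G A B] (φ : G) (q : ℕ) (e : ℕ → A) (i : ℕ) :
    φ (digitExtension q e i) = digitExtension q (fun j => φ (e j)) i := by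
  simp [digitExtension, map_prod]

lemma digitExtension_apply {X K : Type*} [TopologicalSpace X] [TopologicalSpace K] [CommMonoid K]
    [ContinuousMul K] (q : ℕ) (D : ℕ → C(X, K)) (i : ℕ) (x : X) :
    digitExtension q D i x = digitExtension q (fun j => D j x) i := by
  simp [digitExtension, ContinuousMap.prod_apply]

/-! ### From the residue field back to the valued field. -/

section Reduction

variable {R K k : Type*} [CommRing R] [NormedField K] [Field k]

/-- `ι : R → K` identifies `R` with the unit ball of `K`, whose residue map is `ρ`, and the absolute
value of `K` is discrete. -/
structure IsUnitBallReduction (ι : R →+* K) (ρ : R →+* k) (θ : ℝ) : Prop where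
  norm_le : ∀ x, ‖ι x‖ ≤ 1
  exists_eq : ∀ a, ‖a‖ ≤ 1 → ∃ x, ι x = a
  norm_lt_one_iff : ∀ x, ‖ι x‖ < 1 ↔ ρ x = 0
  nonneg : 0 ≤ θ
  lt_one : θ < 1
  norm_le_of_lt : ∀ a : K, ‖a‖ < 1 → ‖a‖ ≤ θ

variable {ι : R →+* K} {ρ : R →+* k} {θ : ℝ} {Δ : ℕ → R →+ R} {ϖ : R}
  [TopologicalSpace R] [CompactSpace R] [IsUltrametricDist K] [CompleteSpace K]

/-- The digit products of a sequence of continuous functions reducing to a higher derivation form an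
orthonormal basis of the space of continuous functions. -/
theorem isOrthonormalBasis_digitExtension (hι : IsUnitBallReduction ι ρ θ)
    (H : IsUnramifiedHigherDerivation Δ ρ ϖ) [Fintype k] {q : ℕ} (hq : Fintype.card k = q)
    (hloc : ∀ f : C(R, K), ∃ N : ℕ, ∀ x y, ϖ ^ N ∣ x - y → ‖f x - f y‖ < 1)
    {D : ℕ → C(R, K)} (hD : ∀ j x, D j x = ι (Δ j x)) :
    IsOrthonormalBasis K (digitExtension q D) := by
  have hq1 : 1 < q := hq ▸ Fintype.one_lt_card
  have happ : ∀ i x, digitExtension q D i x = ι (digitExtension q (fun j => Δ j x) i) := by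
    intro i x
    rw [digitExtension_apply, map_digitExtension]
    simp only [hD]
  have hsum : ∀ (s : ℕ →₀ K) (t : ℕ → R) (N : ℕ), (∀ i < q ^ N, ι (t i) = s i) →
      (∀ i, q ^ N ≤ i → s i = 0) → ∀ x,
      (Finsupp.linearCombination K (digitExtension q D) s) x =
        ι (∑ i ∈ Finset.range (q ^ N), t i * digitExtension q (fun j => Δ j x) i) := by
    intro s t N ht hs x
    rw [Finsupp.linearCombination_apply, Finsupp.sum_of_support_subset s (s := Finset.range (q ^ N))
      (fun i hi => ?_) _ (by simp), ContinuousMap.sum_apply, map_sum]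
    · refine Finset.sum_congr rfl fun i hi => ?_
      rw [ContinuousMap.smul_apply, happ, map_mul, ht i (Finset.mem_range.1 hi), smul_eq_mul]
    · rw [Finset.mem_range]
      by_contra h
      exact Finsupp.mem_support_iff.1 hi (hs i (not_lt.1 h))
  refine isOrthonormalBasis_of_linearIsometry (θ := θ) LinearIsometry.id
    (fun n x => ?_) (fun s hs hm => ?_) hι.nonneg hι.lt_one fun f hf => ?_
  · rw [LinearIsometry.id_apply, happ]
    exact hι.norm_le _
  · choose t ht using fun n => hι.exists_eq (s n) (hs n)
    obtain ⟨m, hm⟩ := hm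
    -- If all values had norm below `1`, the reduced monomials would satisfy a relation, whose
    -- coefficient at `m` is nonzero.
    by_contra! hcon
    obtain ⟨N, hN⟩ : ∃ N, ∀ i ∈ s.support, i < q ^ N := ⟨s.support.sup id, fun i hi =>
      (Finset.le_sup (f := id) hi).trans_lt (Nat.lt_pow_self hq1)⟩
    have hmN : m < q ^ N := hN m (by
      rw [Finsupp.mem_support_iff, ← norm_ne_zero_iff, hm]
      exact one_ne_zero)
    have h0 := H.digitExtension_residue_linearIndependent hq (n := N) (c := fun i => ρ (t i))
      (fun x => by
        have := hcon x
        rw [LinearIsometry.id_apply, hsum s t N (fun i _ => ht i) (fun i hi => by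
          by_contra h
          exact absurd (hN i (Finsupp.mem_support_iff.2 h)) (not_lt.2 hi)),
          hι.norm_lt_one_iff, map_sum] at this
        rw [← this]
        refine Finset.sum_congr rfl fun i _ => ?_
        rw [map_mul, map_digitExtension]) m hmN
    rw [← hι.norm_lt_one_iff, ht, hm] at h0
    exact lt_irrefl _ h0
  · choose g hg using fun x => hι.exists_eq (f x) (hf x)
    obtain ⟨N, hN⟩ := hloc f
    -- The reduction of `f` is invariant under `ϖ ^ N R`, hence a combination of reduced monomials;
    -- any lift of its coefficients will do.
    obtain ⟨c, hc⟩ := H.exists_eq_sum_digitExtension_residue hq (n := N) (g := fun x => ρ (g x))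
      (fun x y hxy => by
        have := hN x y hxy
        rwa [← hg, ← hg, ← map_sub, hι.norm_lt_one_iff, map_sub, sub_eq_zero] at this)
    choose t ht using fun i => H.surjective (c i)
    refine ⟨Finsupp.indicator (Finset.range (q ^ N)) fun i _ => ι (t i), fun x => ?_⟩
    refine hι.norm_le_of_lt _ ?_
    rw [LinearIsometry.id_apply, LinearIsometry.id_apply, hsum _ t N
      (fun i hi => by rw [Finsupp.indicator_of_mem (Finset.mem_range.2 hi)])
      (fun i hi => by rw [Finsupp.indicator_of_notMem (by simpa using hi)]), ← hg, ← map_sub,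
      hι.norm_lt_one_iff, map_sub, hc, sub_eq_zero, map_sum]
    refine Finset.sum_congr rfl fun i _ => ?_
    rw [map_mul, map_digitExtension, ht]

/-- A sequence of continuous functions reducing to a higher derivation is an orthonormal basis of
any space of functions which are linear over a set of representatives of the residue field. -/
theorem isOrthonormalBasis_higherDerivation (hι : IsUnitBallReduction ι ρ θ)
    (H : IsUnramifiedHigherDerivation Δ ρ ϖ)
    (hloc : ∀ f : C(R, K), ∃ N : ℕ, ∀ x y, ϖ ^ N ∣ x - y → ‖f x - f y‖ < 1)
    (V : Submodule K C(R, K)) {A : Set R} (hA : ∀ x, ∃ a ∈ A, ρ a = ρ x)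
    (hadd : ∀ f ∈ V, ∀ x y, f (x + y) = f x + f y)
    (hsmul : ∀ f ∈ V, ∀ a ∈ A, ∀ x, f (a * x) = ι a * f x)
    {D : ℕ → V} (hD : ∀ j x, (D j : C(R, K)) x = ι (Δ j x)) :
    IsOrthonormalBasis K D := by
  classical
  have hle : ∀ j x, ‖(D j : C(R, K)) x‖ ≤ 1 := fun j x => by
    rw [hD]
    exact hι.norm_le _
  refine isOrthonormalBasis_of_linearIsometry (θ := θ) V.subtypeₗᵢ
    hle (fun s hs hm => ?_) hι.nonneg hι.lt_one fun f hf => ?_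
  · choose t ht using fun n => hι.exists_eq (s n) (hs n)
    obtain ⟨n₀, hn₀⟩ := hm
    have hρt : ∀ j, ρ (t j) ≠ 0 → j ∈ s.support := by
      intro j hj
      rw [Finsupp.mem_support_iff]
      intro h
      rw [Ne, ← hι.norm_lt_one_iff, ht, h, norm_zero] at hj
      exact hj one_pos
    -- With `n` the last index of a unit coefficient, evaluation at `ϖ ^ n` isolates it: terms `j <
    -- n` die by triangularity, terms `j > n` by maximality.
    obtain ⟨n, hn, hmax⟩ := ({j ∈ s.support | ρ (t j) ≠ 0}).exists_max_image id ⟨n₀, by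
      have : ρ (t n₀) ≠ 0 := by
        rw [Ne, ← hι.norm_lt_one_iff, ht, hn₀]
        exact lt_irrefl _
      exact Finset.mem_filter.2 ⟨hρt _ this, this⟩⟩
    rw [Finset.mem_filter] at hn
    refine ⟨ϖ ^ n, ?_⟩
    have happ : V.subtypeₗᵢ (Finsupp.linearCombination K D s) (ϖ ^ n) =
        ι (∑ j ∈ s.support, t j * Δ j (ϖ ^ n)) := by
      simp [Finsupp.linearCombination_apply, Finsupp.sum, hD, ht]
    rw [happ, ← not_lt, hι.norm_lt_one_iff, map_sum, Finset.sum_eq_single n]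
    · have h := (H.residue_pow_mul n).2 1
      rw [mul_one, map_one, mul_one] at h
      rw [map_mul, h]
      exact mul_ne_zero hn.2 (pow_ne_zero _ H.residue_ne_zero)
    · intro j hj hne
      rw [map_mul]
      rcases lt_or_gt_of_ne hne with h | h
      · have := (H.residue_pow_mul n).1 j h 1
        rw [mul_one] at this
        rw [this, mul_zero]
      · by_cases h0 : ρ (t j) = 0
        · rw [h0, zero_mul]
        · exact absurd (hmax j (Finset.mem_filter.2 ⟨hj, h0⟩)) (not_le.2 h)
    · intro h
      exact absurd hn.1 h
  · have key : ∀ (N : ℕ) (f : V), (∀ x, ‖(f : C(R, K)) x‖ ≤ 1) →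
        (∀ x, ‖(f : C(R, K)) (ϖ ^ N * x)‖ < 1) → ∃ s : ℕ →₀ K, ∀ x,
          ‖(f : C(R, K)) x - (Finsupp.linearCombination K D s : C(R, K)) x‖ < 1 := by
      intro N
      induction N with
      | zero =>
        intro f _ hf
        exact ⟨0, fun x => by simpa using hf x⟩
      | succ N ih =>
        intro f hf1 hf
        obtain ⟨b, hb⟩ := hι.exists_eq _ (hf1 (ϖ ^ N))
        have hdiag := (H.residue_pow_mul N).2 1
        rw [mul_one, map_one, mul_one] at hdiag
        obtain ⟨t, ht⟩ := H.surjective (ρ b / ρ (Δ 1 ϖ) ^ N)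
        have hf' : ∀ x, ((f - ι t • D N : V) : C(R, K)) x =
            (f : C(R, K)) x - ι t * (D N : C(R, K)) x := fun x => rfl
        obtain ⟨s, hs⟩ := ih (f - ι t • D N) (fun x => by
          rw [hf']
          refine (norm_sub_le_max' _ _).trans (max_le (hf1 x) ?_)
          rw [norm_mul]
          exact mul_le_one₀ (hι.norm_le t) (norm_nonneg _) (hle N x)) fun x => by
          -- Split `x = a + ϖ * y` with `a` a representative: the scalar `a` comes out of `f`, and
          -- the rest lies in `ϖ ^ (N + 1) R`.
          obtain ⟨a, ha, hax⟩ := hA x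
          obtain ⟨y, hy⟩ : ϖ ∣ x - a := by
            rw [← H.residue_eq_zero_iff, map_sub, hax, sub_self]
          have hx : ϖ ^ N * x = a * ϖ ^ N + ϖ ^ (N + 1) * y := by
            rw [pow_succ, mul_assoc, ← hy]
            ring
          have hmem := (f - ι t • D N).2
          rw [hx, hadd _ hmem, hsmul _ hmem _ ha]
          refine (IsUltrametricDist.norm_add_le_max _ _).trans_lt (max_lt ?_ ?_)
          · rw [hf', ← hb, hD, ← map_mul, ← map_sub, ← map_mul, hι.norm_lt_one_iff, map_mul,
              map_sub, map_mul, ht, hdiag, div_mul_cancel₀ _ (pow_ne_zero _ H.residue_ne_zero),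
              sub_self, mul_zero]
          · rw [hf']
            refine (norm_sub_le_max' _ _).trans_lt (max_lt (hf y) ?_)
            rw [hD, ← map_mul, hι.norm_lt_one_iff, map_mul,
              (H.residue_pow_mul (N + 1)).1 N (Nat.lt_succ_self N), mul_zero]
        refine ⟨s + Finsupp.single N (ι t), fun x => ?_⟩
        have h := hs x
        rw [hf'] at h
        convert h using 2
        rw [map_add, Finsupp.linearCombination_single, Submodule.coe_add, ContinuousMap.add_apply,
          Submodule.coe_smul, ContinuousMap.smul_apply, smul_eq_mul]
        ring
    obtain ⟨N, hN⟩ := hloc f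
    obtain ⟨s, hs⟩ := key N f hf fun x => by
      have h0 : (f : C(R, K)) 0 = 0 := by
        have := hadd _ f.2 0 0
        rwa [add_zero, left_eq_add] at this
      have := hN (ϖ ^ N * x) 0 (by simp)
      rwa [h0, sub_zero] at this
    exact ⟨s, fun x => hι.norm_le_of_lt _ (hs x)⟩

end Reduction
end Hyperdiff

namespace Hyperdiff

/-! ### Arithmetic of the completion at `π`. -/

section Place

variable {F : Type*} [Field F] (π : F[X]) (hπ : Irreducible π)

lemma valued_algebraMap (f : F[X]) : Valued.v (algebraMap F[X] (LocalField π hπ) f) =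
    (place π hπ).intValuation f :=
  ((place π hπ).valuedAdicCompletion_eq_valuation (K := RatFunc F) f).trans
    ((place π hπ).valuation_of_algebraMap (K := RatFunc F) f)

lemma algebraMap_eq_algebraMap_algebraMap (f : F[X]) : algebraMap F[X] (LocalField π hπ) f =
    algebraMap (LocalInt π hπ) (LocalField π hπ) (algebraMap F[X] (LocalInt π hπ) f) := rfl

lemma algebraMap_localInt_injective :
    Function.Injective (algebraMap (LocalInt π hπ) (LocalField π hπ)) := Subtype.val_injective

/-- The image of `π` in `𝓞`. -/
noncomputable abbrev uniformizer : LocalInt π hπ := algebraMap F[X] (LocalInt π hπ) π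

lemma uniformizer_ne_zero : uniformizer π hπ ≠ 0 := by
  rw [Ne, FaithfulSMul.algebraMap_eq_zero_iff]
  exact hπ.ne_zero

lemma valued_uniformizer :
    Valued.v (algebraMap F[X] (LocalField π hπ) π) = exp (-1 : ℤ) := by
  rw [valued_algebraMap, (place π hπ).intValuation_singleton hπ.ne_zero rfl]

variable [Fintype F]

lemma norm_localInt_le_one (x : LocalInt π hπ) :
    ‖algebraMap (LocalInt π hπ) (LocalField π hπ) x‖ ≤ 1 :=
  Valued.toNormedField.norm_le_one_iff.2 x.2

lemma exists_localInt_eq {a : LocalField π hπ} (ha : ‖a‖ ≤ 1) :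
    ∃ x, algebraMap (LocalInt π hπ) (LocalField π hπ) x = a :=
  ⟨⟨a, Valued.toNormedField.norm_le_one_iff.1 ha⟩, rfl⟩

/-- The valuation has integer logarithms and `π` has logarithm `-1`, so no norm lies strictly
between `|π|` and `1`. -/
lemma norm_le_norm_uniformizer {a : LocalField π hπ} (ha : ‖a‖ < 1) :
    ‖a‖ ≤ ‖algebraMap (LocalInt π hπ) (LocalField π hπ) (uniformizer π hπ)‖ := by
  rw [← algebraMap_eq_algebraMap_algebraMap, Valued.toNormedField.norm_le_iff, valued_uniformizer]
  have h := Valued.toNormedField.norm_lt_one_iff.1 ha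
  rcases eq_or_ne (Valued.v a) 0 with h0 | h0
  · rw [h0]
    exact zero_le
  · rw [← log_le_iff_le_exp h0]
    rw [← exp_zero, ← log_lt_iff_lt_exp h0] at h
    omega

lemma norm_uniformizer_lt_one :
    ‖algebraMap (LocalInt π hπ) (LocalField π hπ) (uniformizer π hπ)‖ < 1 := by
  rw [← algebraMap_eq_algebraMap_algebraMap, Valued.toNormedField.norm_lt_one_iff,
    valued_uniformizer, ← exp_zero, exp_lt_exp]
  omega

lemma norm_uniformizer_pos :
    0 < ‖algebraMap (LocalInt π hπ) (LocalField π hπ) (uniformizer π hπ)‖ := by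
  rw [norm_pos_iff]
  exact fun h => uniformizer_ne_zero π hπ (algebraMap_localInt_injective π hπ (by rw [h, map_zero]))

/-- The quotient `x / π ^ n` has norm at most `1` exactly when it lies in `𝓞`. -/
lemma norm_le_pow_iff (x : LocalInt π hπ) (n : ℕ) :
    ‖algebraMap (LocalInt π hπ) (LocalField π hπ) x‖ ≤
      ‖algebraMap (LocalInt π hπ) (LocalField π hπ) (uniformizer π hπ)‖ ^ n ↔
    uniformizer π hπ ^ n ∣ x := by
  have hpos := pow_pos (norm_uniformizer_pos π hπ) n
  constructor
  · intro h
    obtain ⟨y, hy⟩ := exists_localInt_eq π hπ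
      (a := algebraMap (LocalInt π hπ) (LocalField π hπ) x /
        algebraMap (LocalInt π hπ) (LocalField π hπ) (uniformizer π hπ) ^ n) (by
      rwa [norm_div, norm_pow, div_le_one₀ hpos])
    refine ⟨y, algebraMap_localInt_injective π hπ ?_⟩
    rw [map_mul, hy, map_pow, mul_div_cancel₀]
    rw [← norm_pos_iff, norm_pow]
    exact hpos
  · rintro ⟨y, rfl⟩
    rw [map_mul, map_pow, norm_mul, norm_pow]
    exact mul_le_of_le_one_right hpos.le (norm_localInt_le_one π hπ y)

lemma norm_lt_one_iff_dvd (x : LocalInt π hπ) :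
    ‖algebraMap (LocalInt π hπ) (LocalField π hπ) x‖ < 1 ↔ uniformizer π hπ ∣ x := by
  have := norm_le_pow_iff π hπ x 1
  rw [pow_one, pow_one] at this
  rw [← this]
  exact ⟨norm_le_norm_uniformizer π hπ, fun h => h.trans_lt (norm_uniformizer_lt_one π hπ)⟩

lemma uniformizer_dvd_algebraMap_iff (f : F[X]) (n : ℕ) :
    uniformizer π hπ ^ n ∣ algebraMap F[X] (LocalInt π hπ) f ↔ π ^ n ∣ f := by
  constructor
  · intro h
    rw [← norm_le_pow_iff, ← norm_pow, ← map_pow, ← map_pow, ← algebraMap_eq_algebraMap_algebraMap,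
      ← algebraMap_eq_algebraMap_algebraMap, Valued.toNormedField.norm_le_iff, map_pow, map_pow,
      valued_uniformizer, valued_algebraMap, ← exp_nsmul, smul_neg, nsmul_one,
      (place π hπ).intValuation_le_pow_iff_mem] at h
    rwa [← Ideal.mem_span_singleton, ← Ideal.span_singleton_pow]
  · rintro ⟨g, rfl⟩
    exact ⟨algebraMap F[X] (LocalInt π hπ) g, by rw [map_mul, map_pow]⟩

/-- Approximate modulo `π` by `exists_close`, divide the error by `π` and repeat. -/
lemma exists_algebraMap_congr (x : LocalInt π hπ) (n : ℕ) :
    ∃ f : F[X], uniformizer π hπ ^ n ∣ x - algebraMap F[X] (LocalInt π hπ) f := by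
  induction n generalizing x with
  | zero => exact ⟨0, by simp⟩
  | succ n ih =>
    obtain ⟨f, hf⟩ := exists_close π hπ x
    have h1 : ‖algebraMap (LocalInt π hπ) (LocalField π hπ)
        (x - algebraMap F[X] (LocalInt π hπ) f)‖ < 1 :=
      Valued.toNormedField.norm_lt_one_iff.2 hf
    obtain ⟨y, hy⟩ := (norm_lt_one_iff_dvd π hπ _).1 h1
    obtain ⟨g, hg⟩ := ih y
    refine ⟨f + π * g, ?_⟩
    rw [map_add, map_mul, ← sub_sub, hy, ← mul_sub, pow_succ']
    exact mul_dvd_mul_left _ hg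

lemma dist_localInt (x y : LocalInt π hπ) :
    dist x y = ‖algebraMap (LocalInt π hπ) (LocalField π hπ) (x - y)‖ :=
  dist_eq_norm (x : LocalField π hπ) (y : LocalField π hπ)

lemma denseRange_algebraMap : DenseRange (algebraMap F[X] (LocalInt π hπ)) := by
  refine Metric.denseRange_iff.2 fun x ε hε => ?_
  obtain ⟨n, hn⟩ := exists_pow_lt_of_lt_one hε (norm_uniformizer_lt_one π hπ)
  obtain ⟨f, hf⟩ := exists_algebraMap_congr π hπ x n
  refine ⟨f, ?_⟩
  rw [dist_localInt]
  exact ((norm_le_pow_iff π hπ _ n).2 hf).trans_lt hn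

/-- Continuous functions on `𝓞` are locally constant modulo the maximal ideal. -/
lemma exists_norm_sub_lt_one (f : C(LocalInt π hπ, LocalField π hπ)) :
    ∃ N : ℕ, ∀ x y, uniformizer π hπ ^ N ∣ x - y → ‖f x - f y‖ < 1 := by
  have huc := CompactSpace.uniformContinuous_of_continuous f.continuous
  obtain ⟨δ, hδ, h⟩ := Metric.uniformContinuous_iff.1 huc 1 one_pos
  obtain ⟨N, hN⟩ := exists_pow_lt_of_lt_one hδ (norm_uniformizer_lt_one π hπ)
  refine ⟨N, fun x y hxy => ?_⟩
  rw [← dist_eq_norm]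
  refine h ?_
  rw [dist_localInt]
  exact ((norm_le_pow_iff π hπ _ N).2 hxy).trans_lt hN

lemma residue_localInt_eq_zero_iff (x : LocalInt π hπ) :
    IsLocalRing.residue (LocalInt π hπ) x = 0 ↔ uniformizer π hπ ∣ x := by
  rw [IsLocalRing.residue_eq_zero_iff, ← norm_lt_one_iff_dvd]
  have := Valuation.mem_maximalIdeal_iff _ (Valued.v : Valuation (LocalField π hπ) ℤᵐ⁰) (a := x)
  exact this.trans (Valued.toNormedField.norm_lt_one_iff (x := (x : LocalField π hπ))).symm

lemma isUnitBallReduction :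
    IsUnitBallReduction (algebraMap (LocalInt π hπ) (LocalField π hπ))
      (IsLocalRing.residue (LocalInt π hπ))
      ‖algebraMap (LocalInt π hπ) (LocalField π hπ) (uniformizer π hπ)‖ where
  norm_le := norm_localInt_le_one π hπ
  exists_eq _ := exists_localInt_eq π hπ
  norm_lt_one_iff x := by rw [norm_lt_one_iff_dvd, residue_localInt_eq_zero_iff]
  nonneg := norm_nonneg _
  lt_one := norm_uniformizer_lt_one π hπ
  norm_le_of_lt _ := norm_le_norm_uniformizer π hπ

/-- The residue field of `𝓞` is `F[T] / π`. -/
lemma adjoinRoot_residue_bijective : ∃ e : AdjoinRoot π →+* IsLocalRing.ResidueField (LocalInt π hπ),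
    Function.Bijective e := by
  have : Fact (Irreducible π) := ⟨hπ⟩
  let φ : F[X] →+* IsLocalRing.ResidueField (LocalInt π hπ) :=
    (IsLocalRing.residue _).comp (algebraMap F[X] (LocalInt π hπ))
  let e : AdjoinRoot π →+* IsLocalRing.ResidueField (LocalInt π hπ) :=
    Ideal.Quotient.lift (Ideal.span {π}) φ fun a ha => by
      obtain ⟨b, rfl⟩ := Ideal.mem_span_singleton.1 ha
      have : φ π = 0 := (residue_localInt_eq_zero_iff π hπ _).2 dvd_rfl
      rw [map_mul, this, zero_mul]
  refine ⟨e, e.injective, fun y => ?_⟩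
  obtain ⟨x, rfl⟩ := IsLocalRing.residue_surjective y
  obtain ⟨f, hf⟩ := exists_algebraMap_congr π hπ x 1
  refine ⟨AdjoinRoot.mk π f, ?_⟩
  rw [pow_one, ← residue_localInt_eq_zero_iff, map_sub, sub_eq_zero] at hf
  exact hf.symm

lemma natCard_residueField : Nat.card (IsLocalRing.ResidueField (LocalInt π hπ)) =
    Fintype.card F ^ π.natDegree := by
  obtain ⟨e, he⟩ := adjoinRoot_residue_bijective π hπ
  have : Module.Finite F (AdjoinRoot π) := (AdjoinRoot.powerBasis hπ.ne_zero).finite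
  rw [← Nat.card_congr (Equiv.ofBijective e he), Module.natCard_eq_pow_finrank (K := F),
    (AdjoinRoot.powerBasis hπ.ne_zero).finrank, AdjoinRoot.powerBasis_dim, Nat.card_eq_fintype_card]

end Place
end Hyperdiff

namespace Hyperdiff

/-! ### Two consequences of the Leibniz rule. -/

section Algebra

open Finset.HasAntidiagonal

/-- Peel off one factor `p` by Leibniz: either it is not differentiated and survives, or at most `j
- 1` derivatives remain for `p ^ N * g`. -/
lemma pow_sub_dvd_hasseDeriv {A : Type*} [CommRing A] (p : A[X]) (N : ℕ) :
    ∀ (j : ℕ) (f : A[X]), p ^ N ∣ f → p ^ (N - j) ∣ hasseDeriv j f := by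
  induction N with
  | zero => simp
  | succ N ih =>
    rintro j _ ⟨g, rfl⟩
    rw [pow_succ', mul_assoc, hasseDeriv_mul]
    refine Finset.dvd_sum fun ab hab => ?_
    obtain ⟨a, b⟩ := ab
    rw [mem_antidiagonal] at hab
    simp only at hab ⊢
    have h := ih b (p ^ N * g) (dvd_mul_right _ _)
    rcases Nat.eq_zero_or_pos a with rfl | ha
    · rw [hasseDeriv_zero']
      -- Here `b = j`; equality fails for `j > N` because subtraction is truncated.
      refine (pow_dvd_pow p (show N + 1 - j ≤ N - b + 1 by omega)).trans ?_
      rw [pow_succ']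
      exact mul_dvd_mul_left _ h
    · exact ((pow_dvd_pow p (by omega)).trans h).mul_left _

/-- In characteristic dividing `q`, higher derivations vanish on the solutions of `a ^ q = a`. -/
lemma higherDerivation_eq_zero_of_pow_eq {R : Type*} [CommRing R] {Δ : ℕ → R →+ R}
    (h0 : ∀ x, Δ 0 x = x)
    (hmul : ∀ n x y, Δ n (x * y) = ∑ ij ∈ antidiagonal n, Δ ij.1 x * Δ ij.2 y)
    {q : ℕ} (hq : q ≠ 0) (hchar : (q : R) = 0) (i : ℕ) (hi : 0 < i) :
    ∀ a : R, a ^ q = a → Δ i a = 0 := by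
  induction i using Nat.strong_induction_on with
  | _ i ih =>
    -- By induction the intermediate `Δ m a`, `0 < m < i`, vanish, so `Δ i` behaves like an ordinary
    -- derivation.
    have hder : ∀ a b : R, a ^ q = a → Δ i (a * b) = a * Δ i b + Δ i a * b := by
      intro a b ha
      rw [hmul, Finset.sum_eq_add (0, i) (i, 0)]
      · simp [h0]
      · simp [hi.ne]
      · rintro ⟨m, n⟩ hmn ⟨h1, h2⟩
        rw [mem_antidiagonal] at hmn
        simp only [ne_eq, Prod.mk.injEq, not_and] at hmn h1 h2 ⊢
        rw [ih m (by omega) (by omega) a ha, zero_mul]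
      · intro h
        exact absurd (mem_antidiagonal.2 (zero_add i)) h
      · intro h
        exact absurd (mem_antidiagonal.2 (add_zero i)) h
    intro a ha
    have hpow : ∀ m : ℕ, Δ i (a ^ (m + 1)) = (m + 1 : ℕ) * a ^ m * Δ i a := by
      intro m
      induction m with
      | zero => simp
      | succ m ihm =>
        rw [pow_succ', hder _ _ ha, ihm]
        push_cast
        ring
    -- Now `Δ i a = Δ i (a ^ q) = q * a ^ (q - 1) * Δ i a = 0`.
    obtain ⟨m, rfl⟩ := Nat.exists_eq_succ_of_ne_zero hq
    rw [← ha, hpow, hchar, zero_mul, zero_mul]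

end Algebra

/-! ### Extension to `𝓞`, Teichmüller representatives and linearity. -/

section Extension

variable {F : Type*} [Field F] [Fintype F] (π : F[X]) (hπ : Irreducible π)

lemma exists_extendsHyperdiff : ∃ D : ℕ → C(LocalInt π hπ, LocalField π hπ),
    ExtendsHyperdiff π hπ D := by
  have key : ∀ j : ℕ, ∃ D : C(LocalInt π hπ, LocalField π hπ), ∀ f : F[X],
      D (algebraMap F[X] (LocalInt π hπ) f) = algebraMap F[X] (LocalField π hπ) (hasseDeriv j f) := by
    intro j
    -- With the `π`-adic metric on `F[X]`, the extension is that of a uniformly continuous map from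
    -- a dense subspace.
    let : PseudoMetricSpace F[X] :=
      PseudoMetricSpace.induced (algebraMap F[X] (LocalInt π hπ)) inferInstance
    have hui : IsUniformInducing (algebraMap F[X] (LocalInt π hπ)) := ⟨rfl⟩
    have huc : UniformContinuous
        (fun f : F[X] => algebraMap F[X] (LocalField π hπ) (hasseDeriv j f)) := by
      refine Metric.uniformContinuous_iff.2 fun ε hε => ?_
      obtain ⟨n, hn⟩ := exists_pow_lt_of_lt_one hε (norm_uniformizer_lt_one π hπ)
      -- The exponent `n + j` leaves `n` factors of `π` after `hasseDeriv j`.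
      refine ⟨_, pow_pos (norm_uniformizer_pos π hπ) (n + j), fun {f g} hfg => ?_⟩
      change dist (algebraMap F[X] (LocalInt π hπ) f) (algebraMap F[X] (LocalInt π hπ) g) < _ at hfg
      rw [dist_localInt, ← map_sub] at hfg
      have h1 := (uniformizer_dvd_algebraMap_iff π hπ _ _).1 ((norm_le_pow_iff π hπ _ _).1 hfg.le)
      have h2 := pow_sub_dvd_hasseDeriv π (n + j) j _ h1
      rw [Nat.add_sub_cancel] at h2
      have h3 := (norm_le_pow_iff π hπ _ _).2 ((uniformizer_dvd_algebraMap_iff π hπ _ _).2 h2)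
      rw [dist_eq_norm, ← map_sub, ← map_sub]
      exact h3.trans_lt hn
    have hd := denseRange_algebraMap π hπ
    exact ⟨⟨_, (uniformContinuous_uniformly_extend hui hd huc).continuous⟩,
      uniformly_extend_of_ind hui hd huc⟩
  choose D hD using key
  exact ⟨D, hD⟩

variable {π hπ}

lemma ExtendsHyperdiff.unique {D D' : ℕ → C(LocalInt π hπ, LocalField π hπ)}
    (hD : ExtendsHyperdiff π hπ D) (hD' : ExtendsHyperdiff π hπ D') : D' = D := by
  funext j
  refine DFunLike.coe_injective ((denseRange_algebraMap π hπ).equalizer (D' j).continuous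
    (D j).continuous (funext fun f => ?_))
  exact (hD' j f).trans (hD j f).symm

open Finset.HasAntidiagonal in
/-- The extended hyperdifferential operators form a higher derivation of `𝓞`. -/
lemma ExtendsHyperdiff.exists_higherDerivation {D : ℕ → C(LocalInt π hπ, LocalField π hπ)}
    (hD : ExtendsHyperdiff π hπ D) : ∃ Δ : ℕ → LocalInt π hπ →+ LocalInt π hπ,
      (∀ j x, D j x = algebraMap (LocalInt π hπ) (LocalField π hπ) (Δ j x)) ∧
      IsUnramifiedHigherDerivation Δ (IsLocalRing.residue (LocalInt π hπ)) (uniformizer π hπ) := by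
  have hd := denseRange_algebraMap π hπ
  have hι := algebraMap_localInt_injective π hπ
  have hιc : Continuous (algebraMap (LocalInt π hπ) (LocalField π hπ)) := continuous_subtype_val
  have hle : ∀ j x, ‖D j x‖ ≤ 1 := by
    intro j x
    refine hd.induction_on (p := fun x => ‖D j x‖ ≤ 1) x
      (isClosed_le (D j).continuous.norm continuous_const) fun f => ?_
    rw [hD, algebraMap_eq_algebraMap_algebraMap]
    exact norm_localInt_le_one π hπ _
  have hadd : ∀ j x y, D j (x + y) = D j x + D j y := by
    intro j x y
    refine hd.induction_on₂ (p := fun x y => D j (x + y) = D j x + D j y)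
      (isClosed_eq (by fun_prop) (by fun_prop)) (fun f g => ?_) x y
    rw [← map_add, hD, hD, hD, map_add, map_add]
  have hmul : ∀ n x y, D n (x * y) = ∑ ij ∈ antidiagonal n, D ij.1 x * D ij.2 y := by
    intro n x y
    refine hd.induction_on₂
      (p := fun x y => D n (x * y) = ∑ ij ∈ antidiagonal n, D ij.1 x * D ij.2 y)
      (isClosed_eq (by fun_prop) (by fun_prop)) (fun f g => ?_) x y
    rw [← map_mul, hD, hasseDeriv_mul, map_sum]
    exact Finset.sum_congr rfl fun ij _ => by rw [map_mul, hD, hD]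
  choose Δ hΔ using fun j x => exists_localInt_eq π hπ (hle j x)
  refine ⟨fun j => AddMonoidHom.mk' (Δ j) fun x y => hι ?_, fun j x => (hΔ j x).symm, ?_⟩
  · rw [map_add, hΔ, hΔ, hΔ, hadd]
  refine ⟨fun x => hι ?_, fun n x y => hι ?_, residue_localInt_eq_zero_iff π hπ, ?_,
    IsLocalRing.residue_surjective⟩
  · refine (hΔ 0 x).trans ?_
    refine hd.induction_on (p := fun x => D 0 x = algebraMap (LocalInt π hπ) (LocalField π hπ) x) x
      (isClosed_eq (D 0).continuous hιc) fun f => ?_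
    rw [hD, hasseDeriv_zero', algebraMap_eq_algebraMap_algebraMap]
  · refine (hΔ n (x * y)).trans ((hmul n x y).trans ?_)
    rw [map_sum]
    refine Finset.sum_congr rfl fun ij _ => ?_
    rw [map_mul]
    exact congrArg₂ _ (hΔ _ _).symm (hΔ _ _).symm
  · have h1 : Δ 1 (uniformizer π hπ) = algebraMap F[X] (LocalInt π hπ) (derivative π) := hι (by
      rw [hΔ, hD, hasseDeriv_one', algebraMap_eq_algebraMap_algebraMap])
    change IsLocalRing.residue _ (Δ 1 (uniformizer π hπ)) ≠ 0
    rw [h1, Ne, residue_localInt_eq_zero_iff]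
    intro h
    have h2 := (uniformizer_dvd_algebraMap_iff π hπ (derivative π) 1).1 (by rwa [pow_one])
    rw [pow_one] at h2
    exact hπ.not_isUnit ((PerfectField.separable_of_irreducible hπ).isUnit_of_dvd' dvd_rfl h2)

variable (π hπ)

lemma card_pow_natDegree_cast_eq_zero :
    ((Fintype.card F ^ π.natDegree : ℕ) : LocalInt π hπ) = 0 := by
  have h : ((Fintype.card F : ℕ) : LocalInt π hπ) = 0 := by
    rw [← map_natCast ((algebraMap F[X] (LocalInt π hπ)).comp C), FiniteField.cast_card_eq_zero,
      map_zero]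
  rw [Nat.cast_pow, h, zero_pow hπ.natDegree_pos.ne']

lemma sub_pow_card_pow (x y : LocalInt π hπ) (n : ℕ) :
    (x - y) ^ (Fintype.card F ^ π.natDegree) ^ n =
      x ^ (Fintype.card F ^ π.natDegree) ^ n - y ^ (Fintype.card F ^ π.natDegree) ^ n := by
  obtain ⟨p, hF, m, hp, hm⟩ := FiniteField.card' F
  have := Fact.mk hp
  have hinj : Function.Injective ((algebraMap F[X] (LocalInt π hπ)).comp C) :=
    (FaithfulSMul.algebraMap_injective F[X] (LocalInt π hπ)).comp C_injective
  have := charP_of_injective_ringHom hinj p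
  rw [hm, ← pow_mul, ← pow_mul]
  exact sub_pow_char_pow x y _

lemma mem_coeffField {a : LocalInt π hπ} :
    a ∈ coeffField π hπ ↔ a ^ (Fintype.card F ^ π.natDegree) = a := Iff.rfl

/-- Teichmüller representatives: `coeffField` surjects onto the residue field. -/
lemma exists_mem_coeffField_residue_eq (x : LocalInt π hπ) :
    ∃ a ∈ coeffField π hπ, IsLocalRing.residue (LocalInt π hπ) a =
      IsLocalRing.residue (LocalInt π hπ) x := by
  set q := Fintype.card F ^ π.natDegree with hq
  have hq1 : 1 < q := Nat.one_lt_pow hπ.natDegree_pos.ne' Fintype.one_lt_card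
  have hcard : Nat.card (IsLocalRing.ResidueField (LocalInt π hπ)) = q := natCard_residueField π hπ
  have hfin : Finite (IsLocalRing.ResidueField (LocalInt π hπ)) :=
    Nat.finite_of_card_ne_zero (by omega)
  have hres : ∀ y : IsLocalRing.ResidueField (LocalInt π hπ), y ^ q = y := by
    intro y
    have := Fintype.ofFinite (IsLocalRing.ResidueField (LocalInt π hπ))
    rw [← hcard, Nat.card_eq_fintype_card, FiniteField.pow_card]
  -- By Frobenius, consecutive terms of `x ^ q ^ n` differ by `(x - x ^ q) ^ q ^ n`, where `π`
  -- divides `x - x ^ q` and `q ^ n ≥ n`. The limit is fixed by the `q`-th power.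
  have hdist : ∀ n, dist (x ^ q ^ n) (x ^ q ^ (n + 1)) ≤
      1 * ‖algebraMap (LocalInt π hπ) (LocalField π hπ) (uniformizer π hπ)‖ ^ n := by
    intro n
    rw [one_mul, dist_localInt, norm_le_pow_iff, pow_succ', pow_mul, ← sub_pow_card_pow]
    refine (pow_dvd_pow _ (Nat.lt_pow_self hq1).le).trans (pow_dvd_pow_of_dvd ?_ _)
    rw [← residue_localInt_eq_zero_iff, map_sub, map_pow, hres, sub_self]
  obtain ⟨a, ha⟩ := cauchySeq_tendsto_of_complete
    (cauchySeq_of_le_geometric _ _ (norm_uniformizer_lt_one π hπ) hdist)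
  refine ⟨a, ?_, ?_⟩
  · rw [mem_coeffField]
    refine tendsto_nhds_unique (ha.pow q) ?_
    simp only [← pow_mul, ← pow_succ]
    exact (tendsto_add_atTop_iff_nat 1).2 ha
  · have hdvd : ∀ n, dist (x ^ q ^ n) x ≤
        ‖algebraMap (LocalInt π hπ) (LocalField π hπ) (uniformizer π hπ)‖ := by
      intro n
      rw [dist_localInt]
      refine norm_le_norm_uniformizer π hπ ?_
      rw [norm_lt_one_iff_dvd, ← residue_localInt_eq_zero_iff, map_sub, map_pow, sub_eq_zero]
      induction n with
      | zero => simp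
      | succ n ih => rw [pow_succ, pow_mul, ih, hres]
    have h := le_of_tendsto (ha.dist tendsto_const_nhds) (Eventually.of_forall hdvd)
    rw [dist_localInt] at h
    rw [← sub_eq_zero, ← map_sub, residue_localInt_eq_zero_iff, ← norm_lt_one_iff_dvd]
    exact h.trans_lt (norm_uniformizer_lt_one π hπ)

variable {π hπ}

/-- All positive-order derivatives of `a` with `a ^ q = a` vanish, so Leibniz for `a * x` leaves
only `a * Δ j x`. -/
lemma ExtendsHyperdiff.mem_linearMaps {D : ℕ → C(LocalInt π hπ, LocalField π hπ)}
    (hD : ExtendsHyperdiff π hπ D) (j : ℕ) : D j ∈ linearMaps π hπ := by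
  obtain ⟨Δ, hΔ, H⟩ := hD.exists_higherDerivation
  have hq0 : Fintype.card F ^ π.natDegree ≠ 0 := pow_ne_zero _ Fintype.card_ne_zero
  refine ⟨fun x y => by rw [hΔ, hΔ, hΔ, map_add, map_add], fun a x => ?_⟩
  have hax : Δ j (a * x) = a * Δ j x := by
    rw [H.leibniz, Finset.sum_eq_single (0, j), H.zero_apply]
    · rintro ⟨m, n⟩ hmn hne
      rw [Finset.HasAntidiagonal.mem_antidiagonal] at hmn
      simp only [ne_eq, Prod.mk.injEq, not_and] at hmn hne ⊢
      rw [higherDerivation_eq_zero_of_pow_eq H.zero_apply H.leibniz hq0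
        (card_pow_natDegree_cast_eq_zero π hπ) m (by omega) a a.2, zero_mul]
    · intro h
      exact absurd (Finset.HasAntidiagonal.mem_antidiagonal.2 (zero_add j)) h
  change D j (a * x) = algebraMap (LocalInt π hπ) (LocalField π hπ) a * D j x
  rw [hΔ, hΔ, hax, map_mul]

end Extension

end Hyperdiff

theorem theorem5p8 {F : Type*} [Field F] [Fintype F] (r d : ℕ) (hr : Fintype.card F = r)
    (π : F[X]) (hπ : Irreducible π) (hd : π.natDegree = d) :
    (∃! D : ℕ → C(Hyperdiff.LocalInt π hπ, Hyperdiff.LocalField π hπ),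
      Hyperdiff.ExtendsHyperdiff π hπ D) ∧
    ∀ D : ℕ → C(Hyperdiff.LocalInt π hπ, Hyperdiff.LocalField π hπ),
      Hyperdiff.ExtendsHyperdiff π hπ D →
      (∃ hD : ∀ j, D j ∈ Hyperdiff.linearMaps π hπ,
        Hyperdiff.IsOrthonormalBasis (Hyperdiff.LocalField π hπ)
          (fun j => (⟨D j, hD j⟩ : Hyperdiff.linearMaps π hπ))) ∧
      Hyperdiff.IsOrthonormalBasis (Hyperdiff.LocalField π hπ)
        (Hyperdiff.digitExtension (r ^ d) D) := by
  refine ⟨?_, fun D hD => ⟨⟨hD.mem_linearMaps, ?_⟩, ?_⟩⟩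
  · obtain ⟨D, hD⟩ := Hyperdiff.exists_extendsHyperdiff π hπ
    exact ⟨D, hD, fun D' hD' => hD.unique hD'⟩
  · obtain ⟨Δ, hΔ, H⟩ := hD.exists_higherDerivation
    exact Hyperdiff.isOrthonormalBasis_higherDerivation (Hyperdiff.isUnitBallReduction π hπ) H
      (Hyperdiff.exists_norm_sub_lt_one π hπ) (Hyperdiff.linearMaps π hπ)
      (A := Hyperdiff.coeffField π hπ) (Hyperdiff.exists_mem_coeffField_residue_eq π hπ)
      (fun f hf => hf.map_add) (fun f hf a ha x => hf.map_smul ⟨a, ha⟩ x) hΔ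
  · obtain ⟨Δ, hΔ, H⟩ := hD.exists_higherDerivation
    have hcard := Hyperdiff.natCard_residueField π hπ
    have hfin : Finite (IsLocalRing.ResidueField (Hyperdiff.LocalInt π hπ)) :=
      Nat.finite_of_card_ne_zero (by
        rw [hcard]
        exact pow_ne_zero _ Fintype.card_ne_zero)
    have := Fintype.ofFinite (IsLocalRing.ResidueField (Hyperdiff.LocalInt π hπ))
    rw [hr, hd, Nat.card_eq_fintype_card] at hcard
    exact Hyperdiff.isOrthonormalBasis_digitExtension (Hyperdiff.isUnitBallReduction π hπ) H hcard
      (Hyperdiff.exists_norm_sub_lt_one π hπ) hΔ
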